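/- For $n\ge 1$, the (unbiased) clique game $\mathrm{Clique}(n)$ is played on the complete graph $K_n$, all of whose edges are uncoloured at the start. Alice (the first player) and Bob (the second player) alternately colour one uncoloured edge each, Alice colouring it red and Bob colouring it blue, with Alice moving first, until all edges are coloured. Let $A$ and $B$ be the spanning subgraphs of $K_n$ formed by the red and by the blue edges at the end. The score is $\omega(A)-\omega(B)$, where $\omega$ is the clique number; Alice plays to maximise it and Bob plays to minimise it. Alice wins $\mathrm{Clique}(n)$ if she can force a positive score; otherwise Bob wins, that is, he can force a score of at most $0$ (so ties count for Bob). (i) For every $n\ge 8$, if Alice wins $\mathrm{Clique}(n)$, then Bob wins $\mathrm{Clique}(n+3)$. (ii) Bob wins $\mathrm{Clique}(n)$ for every $n$ with $3\le n\le 8$. -/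

import Mathlib

namespace CliqueGame

/-- The score `ω(A) - ω(B)` of a finished game: the order of the largest clique all of whose edges
lie in `A` (red, Alice) minus the order of the largest clique all of whose edges lie in `B`
(blue, Bob). -/
noncomputable def finalScore {V : Type*} (A B : Finset (Sym2 V)) : ℤ :=
  ((SimpleGraph.fromEdgeSet (A : Set (Sym2 V))).cliqueNum : ℤ) -
    ((SimpleGraph.fromEdgeSet (B : Set (Sym2 V))).cliqueNum : ℤ)

/-- The score under optimal play from the position in which `U` is the set of uncoloured edges,
`A` the set of red edges, `B` the set of blue edges, and Alice is to move iff `aliceToMove`.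
The player to move colours one edge of `U` and the turn passes to the other player.
Alice maximises the final score, Bob minimises it. -/
noncomputable def positionScore {V : Type*} [DecidableEq V]
    (aliceToMove : Bool) (U A B : Finset (Sym2 V)) : ℤ :=
  if h : U.Nonempty then
    if aliceToMove then
      U.attach.sup' (Finset.attach_nonempty_iff.mpr h)
        (fun e => positionScore false (U.erase e.1) (insert e.1 A) B)
    else
      U.attach.inf' (Finset.attach_nonempty_iff.mpr h)
        (fun e => positionScore true (U.erase e.1) A (insert e.1 B))
  else finalScore A B
termination_by U.card
decreasing_by
  all_goals exact Finset.card_erase_lt_of_mem e.2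

/-- The score of the unbiased clique game on the graph `G`: no edge is coloured at the start and
Alice makes the first move. -/
noncomputable def score {V : Type*} [DecidableEq V] (G : SimpleGraph V) [Fintype G.edgeSet] : ℤ :=
  positionScore true G.edgeFinset ∅ ∅

/-- The first player wins the clique game on `K_n`: she can force a red clique that is larger than
every blue clique. -/
def FirstPlayerWins (n : ℕ) : Prop :=
  0 < score (⊤ : SimpleGraph (Fin n))

/-- The second player wins the clique game on `K_n`: he can force a final position in which no red
clique is larger than the largest blue clique (so ties count for him). -/
def SecondPlayerWins (n : ℕ) : Prop :=
  score (⊤ : SimpleGraph (Fin n)) ≤ 0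

end CliqueGame

/-!
Let Alice win `Clique(n)`, where `n ≥ 9`, and let Bob play on `n + 3` vertices. With his first three
moves he takes an edge `e₀` and two edges `rp`, `rq` such that `e₀` avoids `{r, p, q}`, the three
edges that Alice has coloured by then all meet `{r, p, q}`, and one of them is useless to her. On
the `n` vertices outside `{r, p, q}` he then follows Alice's winning strategy, with `e₀` as its
first move; elsewhere he answers `xp` by `xq` and `xq` by `xp`. A final red clique that does not
contain both `p` and `q` has at most one vertex in `{r, p, q}`, so it is at most one vertex larger
than the red cliques outside, and Bob has a larger clique there. A red clique through `p` and `q`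
has at most two other vertices, since each of them accounts for one of Alice's early edges. Such a
clique cannot beat Bob, for the clique won by Alice's strategy has at least four vertices:
otherwise the graph of its owner would have no four pairwise adjacent vertices and its complement no
triangle, contradicting `R(3, 4) = 9`.

For `n ≤ 8` a strategy for Bob is found by a search inside the kernel, cut off by the
Erdős–Selfridge criterion.
-/

namespace CliqueGame

section Forces

variable {E F : Type*} [DecidableEq E] [DecidableEq F]

/-- In a game where two players alternately claim elements of the finite set `U`, with `M` and `T`
the sets already claimed by the player under consideration and by the opponent, this player can
force that the final sets satisfy `Q`. The player is to move iff `t` is `true`. -/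
inductive Forces (Q : Finset E → Finset E → Prop) :
    Bool → Finset E → Finset E → Finset E → Prop
  | finish {t : Bool} {U M T : Finset E} : U = ∅ → Q M T → Forces Q t U M T
  | move {U M T : Finset E} (e : E) : e ∈ U →
      Forces Q false (U.erase e) (insert e M) T → Forces Q true U M T
  | reply {U M T : Finset E} : U.Nonempty →
      (∀ e ∈ U, Forces Q true (U.erase e) M (insert e T)) → Forces Q false U M T

variable {Q Q' Q₁ Q₂ : Finset E → Finset E → Prop} {t : Bool} {U M T : Finset E}

theorem Forces.of_empty (h : Forces Q t ∅ M T) : Q M T := by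
  generalize hU : (∅ : Finset E) = U at h
  cases h with
  | finish _ h => exact h
  | move e he _ => simp [← hU] at he
  | reply hn _ => simp [← hU] at hn

theorem Forces.reply_mem (h : Forces Q false U M T) {e : E} (he : e ∈ U) :
    Forces Q true (U.erase e) M (insert e T) := by
  cases h with
  | finish hU _ => simp [hU] at he
  | reply _ h => exact h e he

theorem Forces.exists_move (h : Forces Q true U M T) (hU : U.Nonempty) :
    ∃ e ∈ U, Forces Q false (U.erase e) (insert e M) T := by
  cases h with
  | finish h _ => simp [h] at hU
  | move e he h => exact ⟨e, he, h⟩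

theorem forces_empty_iff : Forces Q t ∅ M T ↔ Q M T :=
  ⟨Forces.of_empty, .finish rfl⟩

theorem forces_true_iff (hU : U.Nonempty) :
    Forces Q true U M T ↔ ∃ e ∈ U, Forces Q false (U.erase e) (insert e M) T :=
  ⟨fun h => h.exists_move hU, fun ⟨e, he, h⟩ => .move e he h⟩

theorem forces_false_iff (hU : U.Nonempty) :
    Forces Q false U M T ↔ ∀ e ∈ U, Forces Q true (U.erase e) M (insert e T) :=
  ⟨fun h _ he => h.reply_mem he, .reply hU⟩

theorem forces_false_of (h0 : U = ∅ → Q M T)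
    (h : ∀ e ∈ U, Forces Q true (U.erase e) M (insert e T)) : Forces Q false U M T := by
  rcases U.eq_empty_or_nonempty with hU | hU
  · exact .finish hU (h0 hU)
  · exact .reply hU h

theorem forces_true_of (h0 : U = ∅ → Q M T)
    (h : ∀ e ∈ U, Forces Q false (U.erase e) (insert e M) T) : Forces Q true U M T := by
  rcases U.eq_empty_or_nonempty with hU | ⟨e, he⟩
  · exact .finish hU (h0 hU)
  · exact .move e he (h e he)

theorem Forces.mono (h : Forces Q t U M T) (hQ : ∀ M T, Q M T → Q' M T) : Forces Q' t U M T := by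
  induction h with
  | finish hU h => exact .finish hU (hQ _ _ h)
  | move e he _ ih => exact .move e he ih
  | reply hU _ ih => exact .reply hU ih

theorem Forces.with_invariant {I : Bool → Finset E → Finset E → Finset E → Prop}
    (move : ∀ U M T, ∀ e ∈ U, I true U M T → I false (U.erase e) (insert e M) T)
    (reply : ∀ U M T, ∀ e ∈ U, I false U M T → I true (U.erase e) M (insert e T))
    (h : Forces Q t U M T) (hI : I t U M T) :
    Forces (fun M' T' => Q M' T' ∧ ∃ t', I t' ∅ M' T') t U M T := by
  induction h with
  | finish hU h => exact .finish hU ⟨h, _, hU ▸ hI⟩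
  | move e he _ ih => exact .move e he (ih (move _ _ _ e he hI))
  | reply hU _ ih => exact .reply hU fun e he => ih e he (reply _ _ _ e he hI)

theorem Forces.with_subset (h : Forces Q t U M T) :
    Forces (fun M' T' => Q M' T' ∧ M ⊆ M') t U M T :=
  (h.with_invariant (I := fun _ _ M' _ => M ⊆ M')
    (fun _ _ _ e _ h => h.trans (Finset.subset_insert e _)) (fun _ _ _ _ _ h => h)
    subset_rfl).mono fun _ _ ⟨h, _, h'⟩ => ⟨h, h'⟩

theorem Forces.with_union (h : Forces Q t U M T) :
    Forces (fun M' T' => Q M' T' ∧ M' ∪ T' = U ∪ M ∪ T) t U M T :=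
  (h.with_invariant (I := fun _ U' M' T' => U' ∪ M' ∪ T' = U ∪ M ∪ T)
    (fun _ _ _ e he h => by
      rw [← h, Finset.union_insert, ← Finset.insert_union, Finset.insert_erase he])
    (fun _ _ _ e he h => by
      rw [← h, Finset.union_insert, ← Finset.insert_union, ← Finset.insert_union,
        Finset.insert_erase he]) rfl).mono
    fun _ _ ⟨h, _, h'⟩ => ⟨h, by rwa [Finset.empty_union] at h'⟩

theorem Forces.with_card (h : Forces Q t U M T) :
    Forces (fun M' T' => Q M' T' ∧ 2 * T'.card ≤ 2 * T.card + U.card + 1) t U M T := by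
  refine (h.with_invariant (I := fun t' U' _ T' =>
    2 * T'.card + U'.card + (!t').toNat ≤ 2 * T.card + U.card + 1) ?_ ?_ ?_).mono ?_
  · intro U' _ T' e he h
    have := Finset.card_erase_add_one he
    simp only [Bool.not_true, Bool.not_false, Bool.toNat_false, Bool.toNat_true] at h ⊢
    lia
  · intro U' _ T' e he h
    have := Finset.card_erase_add_one he
    have := Finset.card_insert_le e T'
    simp only [Bool.not_true, Bool.not_false, Bool.toNat_false, Bool.toNat_true] at h ⊢
    lia
  · have := Bool.toNat_le (!t)
    lia
  · rintro M' T' ⟨h, t', h'⟩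
    rw [Finset.card_empty] at h'
    exact ⟨h, by lia⟩

theorem Forces.with_disjoint (h : Forces Q t U M T) (hMT : Disjoint M T) (hU : Disjoint U (M ∪ T)) :
    Forces (fun M' T' => Q M' T' ∧ Disjoint M' T') t U M T := by
  refine (h.with_invariant (I := fun _ U' M' T' => Disjoint M' T' ∧ Disjoint U' (M' ∪ T'))
    ?_ ?_ ⟨hMT, hU⟩).mono fun _ _ ⟨h, _, h', _⟩ => ⟨h, h'⟩ <;>
  · intro U' M' T' e he
    simp only [Finset.disjoint_left, Finset.mem_erase, Finset.mem_union, Finset.mem_insert]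
    grind

/-- A goal that stays reached when the player owns more and the opponent owns less. -/
def MonotoneGoal (Q : Finset E → Finset E → Prop) : Prop :=
  ∀ ⦃M M' T T' : Finset E⦄, M ⊆ M' → T' ⊆ T → Q M T → Q M' T'

theorem Forces.extra_move (hQ : MonotoneGoal Q) (h : Forces Q false U M T) {e : E} (he : e ∈ U) :
    Forces Q false (U.erase e) (insert e M) T := by
  induction hn : U.card using Nat.strong_induction_on generalizing U M T e with
  | _ n ih =>
  refine forces_false_of (fun hU => ?_) fun g hg => ?_
  · have hlast := h.reply_mem he
    rw [hU] at hlast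
    exact hQ (Finset.subset_insert _ _) (Finset.subset_insert _ _) hlast.of_empty
  obtain ⟨hge, hgU⟩ := Finset.mem_erase.1 hg
  have heg : e ∈ U.erase g := Finset.mem_erase.2 ⟨hge.symm, he⟩
  obtain ⟨f, hf, hanswer⟩ := (h.reply_mem hgU).exists_move ⟨e, heg⟩
  have hcard : ((U.erase g).erase f).card < n :=
    hn ▸ (Finset.card_erase_lt_of_mem hf).trans (Finset.card_erase_lt_of_mem hgU)
  rw [Finset.erase_right_comm]
  by_cases hfe : f = e
  · subst hfe
    exact forces_true_of (fun hU => (hU ▸ hanswer).of_empty) fun x hx => ih _ hcard hanswer hx rfl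
  · refine .move f (Finset.mem_erase.2 ⟨hfe, hf⟩) ?_
    rw [Finset.erase_right_comm, Finset.insert_comm]
    exact ih _ hcard hanswer (Finset.mem_erase.2 ⟨Ne.symm hfe, heg⟩) rfl

/-- The board is split by the predicate `P`; answering on the side where the opponent has just
moved, the player reaches the goals of both sides. -/
theorem Forces.prod (P : E → Prop) [DecidablePred P] (h₁ : MonotoneGoal Q₁) (h₂ : MonotoneGoal Q₂)
    (f₁ : Forces Q₁ t (U.filter P) (M.filter P) (T.filter P))
    (f₂ : Forces Q₂ false (U.filter (¬P ·)) (M.filter (¬P ·)) (T.filter (¬P ·))) :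
    Forces (fun M' T' => Q₁ (M'.filter P) (T'.filter P) ∧
      Q₂ (M'.filter (¬P ·)) (T'.filter (¬P ·))) t U M T := by
  induction hn : U.card using Nat.strong_induction_on generalizing U M T t P Q₁ Q₂ with
  | _ n ih =>
  subst hn
  have hcard : ∀ {e}, e ∈ U → (U.erase e).card < U.card := Finset.card_erase_lt_of_mem
  have hfinish : U = ∅ → Q₁ (M.filter P) (T.filter P) ∧ Q₂ (M.filter (¬P ·)) (T.filter (¬P ·)) := by
    rintro rfl
    exact ⟨Forces.of_empty f₁, Forces.of_empty f₂⟩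
  cases t with
  | true =>
    rcases (U.filter P).eq_empty_or_nonempty with hP | hP
    · refine forces_true_of hfinish fun e he => ih _ (hcard he) P h₁ h₂ ?_ ?_ rfl
      · have heP : ¬P e := fun h => by simpa [hP] using Finset.mem_filter.2 ⟨he, h⟩
        rw [hP] at f₁
        exact .finish (by simp [Finset.filter_erase, hP])
          (by simpa only [Finset.filter_insert, if_neg heP] using f₁.of_empty)
      · have heP : ¬P e := fun h => by simpa [hP] using Finset.mem_filter.2 ⟨he, h⟩
        simpa only [Finset.filter_erase, Finset.filter_insert, if_pos heP] using
          f₂.extra_move h₂ (Finset.mem_filter.2 ⟨he, heP⟩)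
    · obtain ⟨e, he, f₁⟩ := f₁.exists_move hP
      obtain ⟨heU, heP⟩ := Finset.mem_filter.1 he
      refine .move e heU (ih _ (hcard heU) P h₁ h₂ ?_ ?_ rfl)
      · simpa only [Finset.filter_erase, Finset.filter_insert, if_pos heP] using f₁
      · simpa [Finset.filter_erase, Finset.filter_insert, heP] using f₂
  | false =>
    refine forces_false_of hfinish fun e he => ?_
    by_cases heP : P e
    · refine ih _ (hcard he) P h₁ h₂ ?_ ?_ rfl
      · simpa only [Finset.filter_erase, Finset.filter_insert, if_pos heP] using
          f₁.reply_mem (Finset.mem_filter.2 ⟨he, heP⟩)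
      · simpa [Finset.filter_erase, Finset.filter_insert, heP] using f₂
    · refine (ih _ (hcard he) (¬P ·) h₂ h₁ (t := true) ?_ ?_ rfl).mono fun _ _ h => ?_
      · simpa only [Finset.filter_erase, Finset.filter_insert, if_pos heP] using
          f₂.reply_mem (Finset.mem_filter.2 ⟨he, heP⟩)
      · simpa [Finset.filter_erase, Finset.filter_insert, heP] using f₁
      · simpa only [not_not, and_comm] using h

/-- The player answers `e` by `σ e` whenever that is still possible. -/
theorem forces_pairing {σ : E → E} (hσ : Function.Involutive σ) :
    Forces (fun _ T' => ∀ e, σ e ≠ e → e ∈ T' → σ e ∈ T' → e ∈ T ∨ σ e ∈ T) false U M T := by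
  suffices H : ∀ T₁, (∀ e, σ e ≠ e → e ∈ T₁ → σ e ∈ T₁ ∪ U → e ∈ T ∨ σ e ∈ T) →
      Forces (fun _ T' => ∀ e, σ e ≠ e → e ∈ T' → σ e ∈ T' → e ∈ T ∨ σ e ∈ T) false U M T₁ from
    H T fun e _ he _ => .inl he
  intro T₁ hT₁
  induction hn : U.card using Nat.strong_induction_on generalizing U M T₁ with
  | _ n ih =>
  subst hn
  have hanswer : ∀ e ∈ U, ∀ W ⊆ U, σ e ∉ W → ∀ x, σ x ≠ x → x ∈ insert e T₁ →
      σ x ∈ insert e T₁ ∪ W → x ∈ T ∨ σ x ∈ T := by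
    intro e he W hW hσe x hσx hx hx'
    have := hσ x
    have := hT₁ (σ x)
    have := hT₁ x
    grind
  refine forces_false_of (fun _ e hσe he h => hT₁ e hσe he (Finset.mem_union_left U h))
    fun e he => ?_
  have hmove : ∀ f ∈ U.erase e, σ e ∉ (U.erase e).erase f → Forces (fun _ T' =>
      ∀ e, σ e ≠ e → e ∈ T' → σ e ∈ T' → e ∈ T ∨ σ e ∈ T) true (U.erase e) M (insert e T₁) :=
    fun f hf hσe => .move f hf <| ih _
      ((Finset.card_erase_lt_of_mem hf).trans (Finset.card_erase_lt_of_mem he)) _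
      (hanswer e he _ ((Finset.erase_subset _ _).trans (Finset.erase_subset _ _)) hσe) rfl
  by_cases hσe : σ e ∈ U.erase e
  · exact hmove (σ e) hσe (Finset.notMem_erase _ _)
  rcases (U.erase e).eq_empty_or_nonempty with h0 | ⟨f, hf⟩
  · exact .finish h0 fun x hσx hx hx' => hanswer e he ∅ (Finset.empty_subset U)
      (Finset.notMem_empty _) x hσx hx (Finset.mem_union_left _ hx')
  · exact hmove f hf fun h => hσe (Finset.mem_of_mem_erase h)

theorem forces_image_iff {φ : E → F} {R : Finset F → Finset F → Prop} (hφ : Set.InjOn φ U) :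
    Forces R t (U.image φ) (M.image φ) (T.image φ) ↔
      Forces (fun M' T' => R (M'.image φ) (T'.image φ)) t U M T := by
  induction hn : U.card using Nat.strong_induction_on generalizing U M T t with
  | _ n ih =>
  subst hn
  rcases U.eq_empty_or_nonempty with rfl | hU
  · simp only [Finset.image_empty, forces_empty_iff]
  have herase : ∀ e ∈ U, ∀ t M T,
      Forces R t ((U.image φ).erase (φ e)) (M.image φ) (T.image φ) ↔
        Forces (fun M' T' => R (M'.image φ) (T'.image φ)) t (U.erase e) M T := by
    intro e he t M T
    rw [← ih _ (Finset.card_erase_lt_of_mem he)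
      (hφ.mono (Finset.coe_subset.2 (Finset.erase_subset e U))) rfl,
      ← Finset.sdiff_singleton_eq_erase, ← Finset.sdiff_singleton_eq_erase,
      Finset.image_sdiff_of_injOn hφ (Finset.singleton_subset_iff.2 he), Finset.image_singleton]
  cases t with
  | true =>
    rw [forces_true_iff (hU.image φ), forces_true_iff hU, Finset.exists_mem_image]
    refine exists_congr fun e => and_congr_right fun he => ?_
    rw [← Finset.image_insert, herase e he]
  | false =>
    rw [forces_false_iff (hU.image φ), forces_false_iff hU, Finset.forall_mem_image]
    refine forall₂_congr fun e he => ?_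
    rw [← Finset.image_insert, herase e he]

end Forces

section Score

variable {V W : Type*}

/-- The graph whose edges have been coloured with a given colour. -/
abbrev graph (A : Finset (Sym2 V)) : SimpleGraph V :=
  .fromEdgeSet A

/-- The board of the clique game on the complete graph. -/
abbrev allEdges (V : Type*) [Fintype V] [DecidableEq V] : Finset (Sym2 V) :=
  (⊤ : SimpleGraph V).edgeFinset

theorem mem_allEdges [Fintype V] [DecidableEq V] {e : Sym2 V} : e ∈ allEdges V ↔ ¬e.IsDiag := by
  simp

theorem exists_equiv_of_card_eq [Fintype V] [Fintype W] (h : Fintype.card V = Fintype.card W)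
    {a b : V} (hab : a ≠ b) {c d : W} (hcd : c ≠ d) : ∃ φ : V ≃ W, φ a = c ∧ φ b = d := by
  obtain ⟨σ, ha, hb⟩ := MulAction.is_two_pretransitive_iff.1
    (Equiv.Perm.isMultiplyPretransitive W 2) ((Fintype.equivOfCardEq h).injective.ne hab) hcd
  exact ⟨(Fintype.equivOfCardEq h).trans σ, ha, hb⟩

theorem cliqueNum_lt_iff [Finite V] {G : SimpleGraph V} {k : ℕ} :
    G.cliqueNum < k ↔ G.CliqueFree k := by
  constructor
  · rintro h s hs
    exact h.not_ge (hs.card_eq ▸ hs.isClique.card_le_cliqueNum)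
  · intro h
    obtain ⟨s, hs⟩ := G.exists_isNClique_cliqueNum
    exact lt_of_not_ge fun hk => h.mono hk s hs

theorem cliqueNum_mono [Finite V] {G H : SimpleGraph V} (h : G ≤ H) : G.cliqueNum ≤ H.cliqueNum :=
  Nat.lt_succ_iff.1 (cliqueNum_lt_iff.2 ((cliqueNum_lt_iff.1 (Nat.lt_succ_self _)).anti h))

theorem cliqueNum_map [Nonempty V] [Finite V] [Finite W] (G : SimpleGraph V) (φ : V ↪ W) :
    (G.map φ).cliqueNum = G.cliqueNum :=
  eq_of_forall_gt_iff fun k => by simp only [cliqueNum_lt_iff, SimpleGraph.cliqueFree_map_iff]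

theorem graph_mono {A B : Finset (Sym2 V)} (h : A ⊆ B) : graph A ≤ graph B :=
  SimpleGraph.fromEdgeSet_mono (Finset.coe_subset.2 h)

theorem graph_image_map [DecidableEq W] (A : Finset (Sym2 V)) (φ : V ↪ W) :
    graph (A.image (Sym2.map φ)) = (graph A).map φ := by
  ext x y
  simp only [SimpleGraph.fromEdgeSet_adj, SimpleGraph.map_adj, Finset.mem_coe, Finset.mem_image]
  constructor
  · rintro ⟨⟨e, he, hxy⟩, hne⟩
    induction e with | _ u v
    rcases Sym2.eq_iff.1 hxy with ⟨rfl, rfl⟩ | ⟨rfl, rfl⟩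
    · exact ⟨u, v, ⟨he, fun h => hne (h ▸ rfl)⟩, rfl, rfl⟩
    · exact ⟨v, u, ⟨Sym2.eq_swap ▸ he, fun h => hne (h ▸ rfl)⟩, rfl, rfl⟩
  · rintro ⟨u, v, ⟨he, hne⟩, rfl, rfl⟩
    exact ⟨⟨_, he, rfl⟩, φ.injective.ne hne⟩

theorem positionScore_le_iff [DecidableEq V] {c : ℤ} {t : Bool} {U A B : Finset (Sym2 V)} :
    positionScore (!t) U A B ≤ c ↔ Forces (fun B A => finalScore A B ≤ c) t U B A := by
  induction hn : U.card using Nat.strong_induction_on generalizing t U A B with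
  | _ n ih =>
  subst hn
  rw [positionScore]
  split_ifs with hU ht
  · obtain rfl : t = false := by simpa using ht
    simp only [forces_false_iff hU, Finset.sup'_le_iff, Finset.mem_attach, true_imp_iff,
      Subtype.forall]
    exact forall₂_congr fun e he => ih _ (Finset.card_erase_lt_of_mem he) (t := true) rfl
  · obtain rfl : t = true := by simpa using ht
    simp only [forces_true_iff hU, Finset.inf'_le_iff, Finset.mem_attach, true_and,
      Subtype.exists, exists_prop]
    exact exists_congr fun e => and_congr_right fun he =>
      ih _ (Finset.card_erase_lt_of_mem he) (t := false) rfl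
  · rw [Finset.not_nonempty_iff_eq_empty.1 hU, forces_empty_iff]

theorem lt_positionScore_iff [DecidableEq V] {c : ℤ} {t : Bool} {U A B : Finset (Sym2 V)} :
    c < positionScore t U A B ↔ Forces (fun A B => c < finalScore A B) t U A B := by
  induction hn : U.card using Nat.strong_induction_on generalizing t U A B with
  | _ n ih =>
  subst hn
  rw [positionScore]
  split_ifs with hU ht
  · subst ht
    simp only [forces_true_iff hU, Finset.lt_sup'_iff, Finset.mem_attach, true_and,
      Subtype.exists, exists_prop]
    exact exists_congr fun e => and_congr_right fun he =>
      ih _ (Finset.card_erase_lt_of_mem he) rfl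
  · obtain rfl : t = false := by simpa using ht
    simp only [forces_false_iff hU, Finset.lt_inf'_iff, Finset.mem_attach, true_imp_iff,
      Subtype.forall]
    exact forall₂_congr fun e he => ih _ (Finset.card_erase_lt_of_mem he) rfl
  · rw [Finset.not_nonempty_iff_eq_empty.1 hU, forces_empty_iff]

theorem secondPlayerWins_iff {n : ℕ} : SecondPlayerWins n ↔
    Forces (fun B A => (graph A).cliqueNum ≤ (graph B).cliqueNum) false (allEdges (Fin n)) ∅ ∅ := by
  rw [SecondPlayerWins, score]
  refine (positionScore_le_iff (t := false)).trans ?_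
  simp only [finalScore, sub_nonpos, Nat.cast_le]

theorem firstPlayerWins_iff {n : ℕ} : FirstPlayerWins n ↔
    Forces (fun A B => (graph B).cliqueNum < (graph A).cliqueNum) true (allEdges (Fin n)) ∅ ∅ := by
  rw [FirstPlayerWins, score, lt_positionScore_iff]
  simp only [finalScore, sub_pos, Nat.cast_lt]

end Score

section Search

/-- A family of vertex sets with integer weights. Vertex sets, in particular edges, are encoded as
bit masks. -/
abbrev WeightedFamily := List (ℕ × ℕ)

/-- Inclusion of the vertex sets with masks `e` and `k`. -/
def submask (e k : ℕ) : Bool :=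
  Nat.beq (Nat.land k e) e

/-- `f n`, where the kernel evaluates `n` to a literal before substituting it into `f`. -/
def forced (n : ℕ) (f : ℕ → Bool) : Bool :=
  n.casesOn (f 0) fun m => f m.succ

/-- `F A`, where the kernel evaluates `A` before substituting it into `F`. -/
def forcedFamily : WeightedFamily → (WeightedFamily → Bool) → Bool
  | [], F => F []
  | (k, w) :: A, F =>
    forced k fun k => forced w fun w => forcedFamily A fun A => F ((k, w) :: A)

/-- The total weight of a family. -/
def total (A : WeightedFamily) : ℕ :=
  A.foldr (fun k s => k.2 + s) 0

/-- The weight of the members of `A` that contain the edge `e`. Written with recursors, which the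
kernel unfolds faster than pattern matching. -/
def degree (A : WeightedFamily) (e : ℕ) : ℕ :=
  A.rec 0 fun k _ s => (submask e k.1).rec s (Nat.add k.2 s)

/-- The members of `A` that do not contain the edge `e`. -/
def without (e : ℕ) (A : WeightedFamily) : WeightedFamily :=
  A.filter fun k => !submask e k.1

/-- The family `A` with the weights of the members that contain the edge `e` multiplied by `b`. -/
def scaled (b e : ℕ) (A : WeightedFamily) : WeightedFamily :=
  A.map fun k => (k.1, bif submask e k.1 then b * k.2 else k.2)

/-- Some member of `B` has no edge in `U`. -/
def isBuilt (U : List ℕ) (B : WeightedFamily) : Bool :=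
  B.any fun b => U.all fun e => !submask e b.1

/-- A strategy of depth `n`, verified against all replies, for the player who moves on the
uncoloured edges `U` and has to own an edge in every member of `A` and all edges of some member
of `B`. In `A` are the sets without an edge of the player, with weights `t / 2 ^ c` where `c` is
the number of uncoloured edges; in `B` are the sets without an edge of the opponent, and their
weights only guide the choice of the move. Once a member of `B` is built, total weight less than
`t` after a reply ends the search (`forces_blocks`). -/
def search (t : ℕ) : ℕ → List ℕ → WeightedFamily → WeightedFamily → Bool
  | 0, _, _, _ => false
  | n + 1, U, A, B =>
    match U.argmax fun e => degree A e + bif isBuilt U B then 0 else 10 * degree B e with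
    | none => false
    | some f =>
      forced f fun f =>
      forcedFamily (without f A) fun A =>
      forcedFamily (scaled 4 f B) fun B =>
      let U := U.erase f
      forced (bif isBuilt U B then total A else t) fun s =>
      (!U.isEmpty || s.blt t) &&
      U.all fun e => (s + degree A e).blt t ||
        forcedFamily (scaled 2 e A) fun A =>
        forcedFamily (without e B) fun B => search t n (U.erase e) A B

theorem forced_eq (n : ℕ) (f : ℕ → Bool) : forced n f = f n := by
  cases n <;> rfl

theorem forcedFamily_eq (A : WeightedFamily) (F : WeightedFamily → Bool) :
    forcedFamily A F = F A := by
  induction A generalizing F with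
  | nil => rfl
  | cons k A ih => simp only [forcedFamily, forced_eq, ih]

theorem total_cons (k : ℕ × ℕ) (A : WeightedFamily) : total (k :: A) = k.2 + total A := rfl

theorem degree_cons (k : ℕ × ℕ) (A : WeightedFamily) (e : ℕ) :
    degree (k :: A) e = bif submask e k.1 then k.2 + degree A e else degree A e := by
  cases h : submask e k.1 <;> simp only [degree, h] <;> rfl

theorem le_total {A : WeightedFamily} {k : ℕ × ℕ} (h : k ∈ A) : k.2 ≤ total A := by
  induction A with
  | nil => simp at h
  | cons k' A ih =>
    rw [total_cons]
    rcases List.mem_cons.1 h with rfl | h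
    · exact Nat.le_add_right _ _
    · exact (ih h).trans (Nat.le_add_left _ _)

theorem total_scaled_two (e : ℕ) (A : WeightedFamily) :
    total (scaled 2 e A) = total A + degree A e := by
  induction A with
  | nil => rfl
  | cons k A ih =>
    rw [scaled, List.map_cons, total_cons, ← scaled, ih, total_cons, degree_cons]
    cases submask e k.1 <;> simp only [cond_true, cond_false] <;> ring

theorem total_without (e : ℕ) (A : WeightedFamily) :
    total (without e A) + degree A e = total A := by
  induction A with
  | nil => rfl
  | cons k A ih =>
    rw [total_cons, ← ih, degree_cons, without, List.filter_cons]
    cases h : submask e k.1 <;>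
      simp [total_cons, without] <;> ring

theorem degree_without_le (f : ℕ) (A : WeightedFamily) (e : ℕ) :
    degree (without f A) e ≤ degree A e := by
  induction A with
  | nil => rfl
  | cons k A ih =>
    rw [without, List.filter_cons, degree_cons]
    rw [without] at ih
    split_ifs <;> cases h : submask e k.1 <;> simp only [degree_cons, h, cond_true, cond_false] <;>
      lia

variable {t : ℕ} {𝒦 𝒢 : Set ℕ} {U M T U₀ : Finset ℕ} {A B : WeightedFamily}

/-- Every member of `𝒦` contains an edge in `M`, or occurs in `A` with weight at least `t / 2 ^ c`,
where `c` is the number of its edges in `U`. -/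
def Weighs (t : ℕ) (𝒦 : Set ℕ) (U M : Finset ℕ) (A : WeightedFamily) : Prop :=
  ∀ k ∈ 𝒦, (∃ e ∈ M, submask e k) ∨ ∃ w, (k, w) ∈ A ∧ t ≤ w * 2 ^ (U.filter (submask · k)).card

/-- Every member of `B` is in `𝒢` and has all its edges in `U ∪ M`, where `U₀` is the set of all
edges. -/
def Buildable (𝒢 : Set ℕ) (U₀ U M : Finset ℕ) (B : WeightedFamily) : Prop :=
  ∀ k ∈ B, k.1 ∈ 𝒢 ∧ ∀ e ∈ U₀, submask e k.1 → e ∈ U ∪ M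

theorem Weighs.claim (h : Weighs t 𝒦 U M A) (f : ℕ) :
    Weighs t 𝒦 (U.erase f) (insert f M) (without f A) := by
  intro k hk
  by_cases hf : submask f k
  · exact .inl ⟨f, Finset.mem_insert_self f M, hf⟩
  refine (h k hk).imp (fun ⟨e, he, hek⟩ => ⟨e, Finset.mem_insert_of_mem he, hek⟩) ?_
  rintro ⟨w, hw, ht⟩
  refine ⟨w, List.mem_filter.2 ⟨hw, by simpa using hf⟩, ?_⟩
  rwa [Finset.filter_erase, Finset.erase_eq_of_notMem (by simp [hf])]

theorem Weighs.lose (h : Weighs t 𝒦 U M A) (e : ℕ) :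
    Weighs t 𝒦 (U.erase e) M (scaled 2 e A) := by
  refine fun k hk => (h k hk).imp_right ?_
  rintro ⟨w, hw, ht⟩
  refine ⟨_, List.mem_map_of_mem hw, ht.trans ?_⟩
  rw [Finset.filter_erase]
  cases he : submask e k
  · rw [Finset.erase_eq_of_notMem (by simp [he]), cond_false]
  · rw [cond_true, mul_comm 2, mul_assoc, ← pow_succ']
    exact Nat.mul_le_mul_left w (Nat.pow_le_pow_right two_pos
      (Nat.sub_le_iff_le_add.1 Finset.pred_card_le_card_erase))

theorem Weighs.blocks (h : Weighs t 𝒦 ∅ M A) (hA : total A < t) :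
    ∀ k ∈ 𝒦, ∃ e ∈ M, submask e k := by
  refine fun k hk => (h k hk).resolve_right ?_
  rintro ⟨w, hw, ht⟩
  have := le_total hw
  simp only [Finset.filter_empty, Finset.card_empty, pow_zero, mul_one] at ht
  lia

theorem Buildable.claim (h : Buildable 𝒢 U₀ U M B) (b f : ℕ) :
    Buildable 𝒢 U₀ (U.erase f) (insert f M) (scaled b f B) := by
  simp only [Buildable, scaled, List.forall_mem_map]
  refine fun k hk => ⟨(h k hk).1, fun e he hek => ?_⟩
  have := (h k hk).2 e he hek
  grind

theorem Buildable.lose (h : Buildable 𝒢 U₀ U M B) (e : ℕ) :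
    Buildable 𝒢 U₀ (U.erase e) M (without e B) := by
  intro k hk
  obtain ⟨hk, hek⟩ := List.mem_filter.1 hk
  refine ⟨(h k hk).1, fun e' he' he'k => ?_⟩
  have := (h k hk).2 e' he' he'k
  grind

theorem Buildable.exists_built {U : List ℕ} (h : Buildable 𝒢 U₀ U.toFinset M B)
    (hB : isBuilt U B) : ∃ k ∈ 𝒢, ∀ e ∈ U₀, submask e k → e ∈ M := by
  simp only [isBuilt, List.any_eq_true, List.all_eq_true] at hB
  obtain ⟨k, hk, hU⟩ := hB
  refine ⟨k.1, (h k hk).1, fun e he hek => ?_⟩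
  refine (Finset.mem_union.1 ((h k hk).2 e he hek)).resolve_left fun heU => ?_
  simpa [hek] using hU e (List.mem_toFinset.1 heU)

/-- The Erdős–Selfridge criterion: claiming an edge `f` of maximal degree lowers the total weight
by at least as much as any reply raises it. -/
theorem forces_blocks (h : Weighs t 𝒦 U M A) (hA : total A < t) :
    Forces (fun M' _ => ∀ k ∈ 𝒦, ∃ e ∈ M', submask e k) true U M T := by
  induction hn : U.card using Nat.strong_induction_on generalizing U M T A with
  | _ n ih =>
  subst hn
  rcases U.eq_empty_or_nonempty with rfl | hU
  · exact .finish rfl (h.blocks hA)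
  obtain ⟨f, hf, hmax⟩ := U.exists_max_image (degree A) hU
  have hwithout := total_without f A
  refine .move f hf (forces_false_of (fun h0 => ?_) fun e he => ?_)
  · exact (h0 ▸ h.claim f).blocks (by lia)
  · refine ih _ ((Finset.card_erase_lt_of_mem he).trans (Finset.card_erase_lt_of_mem hf))
      ((h.claim f).lose e) ?_ rfl
    rw [total_scaled_two]
    have := degree_without_le f A e
    have := hmax e (Finset.mem_of_mem_erase he)
    lia

theorem exists_claim_of_search {n : ℕ} {U : List ℕ} (h : search t (n + 1) U A B) :
    ∃ f ∈ U, (U.erase f = [] → isBuilt (U.erase f) (scaled 4 f B) ∧ total (without f A) < t) ∧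
      ∀ e ∈ U.erase f,
        (isBuilt (U.erase f) (scaled 4 f B) ∧ total (without f A) + degree (without f A) e < t) ∨
        search t n ((U.erase f).erase e) (scaled 2 e (without f A)) (without e (scaled 4 f B)) := by
  rw [search] at h
  split at h
  · simp at h
  rename_i f hf
  simp only [forced_eq, forcedFamily_eq, Bool.and_eq_true, List.all_eq_true, Bool.or_eq_true,
    Nat.blt_eq, Bool.not_eq_true', List.isEmpty_eq_false_iff] at h
  obtain ⟨hlast, hreply⟩ := h
  refine ⟨f, List.argmax_mem hf, ?_, fun e he => (hreply e he).imp_left ?_⟩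
  · intro h0
    have hlt := hlast.resolve_left fun hne => hne h0
    cases hd : isBuilt (U.erase f) (scaled 4 f B)
    · simp [hd] at hlt
    · simpa [hd] using hlt
  · cases hd : isBuilt (U.erase f) (scaled 4 f B) <;> simp

theorem forces_of_search {n : ℕ} {U : List ℕ} (hU : U.Nodup) (hA : Weighs t 𝒦 U.toFinset M A)
    (hB : Buildable 𝒢 U₀ U.toFinset M B) (h : search t n U A B) :
    Forces (fun M' _ => (∀ k ∈ 𝒦, ∃ e ∈ M', submask e k) ∧ ∃ k ∈ 𝒢, ∀ e ∈ U₀, submask e k → e ∈ M')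
      true U.toFinset M T := by
  induction n generalizing U M T A B with
  | zero => simp [search] at h
  | succ n ih =>
  obtain ⟨f, hf, hlast, hreply⟩ := exists_claim_of_search h
  have herase : ∀ {U : List ℕ}, U.Nodup → ∀ e, (U.erase e).toFinset = U.toFinset.erase e :=
    fun hU e => by ext; simp [hU.mem_erase_iff]
  have hU' := hU.erase f
  have hA' := hA.claim f
  have hB' := hB.claim 4 f
  refine .move f (List.mem_toFinset.2 hf) ?_
  rw [← herase hU] at hA' hB' ⊢
  refine forces_false_of (fun h0 => ?_) fun e he => ?_
  · obtain ⟨hbuilt, hlt⟩ := hlast (List.toFinset_eq_empty_iff _ |>.1 h0)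
    exact ⟨(h0 ▸ hA').blocks hlt, hB'.exists_built hbuilt⟩
  have hA'' := hA'.lose e
  have hB'' := hB'.lose e
  rcases hreply e (List.mem_toFinset.1 he) with ⟨hbuilt, hlt⟩ | h
  · obtain ⟨k, hk, hkM⟩ := hB'.exists_built hbuilt
    refine (forces_blocks hA'' ?_).with_subset.mono fun M' _ hM' =>
      ⟨hM'.1, k, hk, fun e he hek => hM'.2 (hkM e he hek)⟩
    rwa [total_scaled_two]
  · rw [← herase hU'] at hA'' hB'' ⊢
    exact ih (hU'.erase e) hA'' hB'' h

end Search

section Masks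

/-- The masks of the `k`-element subsets of `{0, …, n - 1}`. -/
def subsets (n k : ℕ) : List ℕ :=
  (List.range (2 ^ n)).filter fun m => (List.range n).countP m.testBit == k

/-- The search finds a strategy on `n` vertices for the player who moves after the opponent has
claimed the edge `{0, 1}`, of mask `3`, and who has to own a clique of size `r` and an edge in every
set of `q` vertices. -/
def wins (n q r : ℕ) : Bool :=
  let U := (subsets n 2).erase 3
  search (2 ^ q.choose 2) U.length U
    ((subsets n q).map fun k => (k, 2 ^ (q.choose 2 - U.countP (submask · k))))
    (((subsets n r).filter fun k => !submask 3 k).map (·, 1))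

theorem forces_masks_of_wins {n q r : ℕ} (h : wins n q r) : Forces (fun M _ =>
    (∀ k ∈ subsets n q, ∃ e ∈ M, submask e k) ∧
      ∃ k ∈ subsets n r, ∀ e ∈ subsets n 2, submask e k → e ∈ M)
    true ((subsets n 2).toFinset.erase 3) ∅ {3} := by
  have hnodup : (subsets n 2).Nodup := List.nodup_range.filter _
  have herase : ((subsets n 2).erase 3).toFinset = (subsets n 2).toFinset.erase 3 := by
    ext; simp [hnodup.mem_erase_iff]
  rw [← herase]
  refine (forces_of_search (𝒦 := {k | k ∈ subsets n q})
    (𝒢 := {k | k ∈ subsets n r ∧ ¬submask 3 k}) (U₀ := (subsets n 2).toFinset)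
    (hnodup.erase 3) ?_ ?_ h).mono ?_
  · refine fun k hk => .inr ⟨_, List.mem_map_of_mem hk, ?_⟩
    rw [← List.toFinset_filter, List.toFinset_card_of_nodup ((hnodup.erase 3).filter _),
      ← List.countP_eq_length_filter, ← pow_add]
    exact Nat.pow_le_pow_right two_pos le_tsub_add
  · simp only [Buildable, List.forall_mem_map, List.mem_filter, herase]
    refine fun k hk => ⟨by simpa using hk, fun e he hek => ?_⟩
    refine Finset.mem_union_left _ (Finset.mem_erase.2 ⟨?_, he⟩)
    rintro rfl
    simp [hek] at hk
  · rintro M _ ⟨h₁, k, ⟨hk, -⟩, h₂⟩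
    exact ⟨h₁, k, hk, fun e he => h₂ e (List.mem_toFinset.2 he)⟩

/-- The mask of a vertex set, the vertices being numbered by `f`. -/
def mask {V : Type*} (f : V ↪ ℕ) (s : Finset V) : ℕ :=
  Finset.equivBitIndices.symm (s.map f)

variable {V : Type*} {f : V ↪ ℕ}

theorem mask_injective : Function.Injective (mask f) :=
  Finset.equivBitIndices.symm.injective.comp (Finset.map_injective f)

theorem submask_iff {e k : ℕ} :
    submask e k ↔ Finset.equivBitIndices e ⊆ Finset.equivBitIndices k := by
  simp only [submask, Nat.beq_eq, Nat.land_eq, Finset.subset_iff, Finset.equivBitIndices_apply,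
    List.mem_toFinset, Nat.mem_bitIndices]
  constructor
  · intro h i hi
    rw [← h, Nat.testBit_and, Bool.and_eq_true] at hi
    exact hi.1
  · intro h
    refine Nat.eq_of_testBit_eq fun i => ?_
    rw [Nat.testBit_and, Bool.and_eq_right_iff_imp]
    exact @h i

theorem submask_mask_iff {s t : Finset V} : submask (mask f s) (mask f t) ↔ s ⊆ t := by
  simp only [submask_iff, mask, Equiv.apply_symm_apply, Finset.map_subset_map]

theorem mem_subsets_iff {n k m : ℕ} :
    m ∈ subsets n k ↔ Finset.equivBitIndices m ∈ (Finset.range n).powersetCard k := by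
  simp only [subsets, List.mem_filter, List.mem_range, beq_iff_eq, Finset.mem_powersetCard]
  have hlt : m < 2 ^ n ↔ Finset.equivBitIndices m ⊆ Finset.range n := by
    simp only [Finset.subset_iff, Finset.equivBitIndices_apply, List.mem_toFinset, Finset.mem_range]
    refine ⟨fun hm i hi => ?_, fun h => Nat.lt_pow_two_of_testBit m fun i hi => ?_⟩
    · exact (Nat.pow_lt_pow_iff_right one_lt_two).1
        ((Nat.two_pow_le_of_mem_bitIndices hi).trans_lt hm)
    · exact eq_false_of_ne_true fun hmi => hi.not_gt (h (Nat.mem_bitIndices.2 hmi))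
  rw [hlt]
  refine and_congr_right fun h => ?_
  have hfilter : ((List.range n).filter m.testBit).toFinset = Finset.equivBitIndices m := by
    ext i
    have := @h i
    simp_all [Finset.equivBitIndices_apply]
  rw [← hfilter, List.toFinset_card_of_nodup (List.nodup_range.filter _),
    List.countP_eq_length_filter]

theorem mem_subsets_iff_exists_mask [Fintype V] {n k m : ℕ}
    (hf : Finset.univ.map f = Finset.range n) :
    m ∈ subsets n k ↔ ∃ s : Finset V, s.card = k ∧ mask f s = m := by
  simp only [mem_subsets_iff, ← hf, Finset.powersetCard_map, Finset.mem_map,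
    Finset.mem_powersetCard_univ, mask, Equiv.symm_apply_eq]
  rfl

theorem exists_mask_eq_three [Fintype V] [DecidableEq V] {n : ℕ} (hV : Fintype.card V = n)
    {a b : V} (hab : a ≠ b) :
    ∃ f : V ↪ ℕ, Finset.univ.map f = Finset.range n ∧ mask f {a, b} = 3 := by
  have hn : 1 < n := hV ▸ Fintype.one_lt_card_iff.2 ⟨a, b, hab⟩
  obtain ⟨φ, ha, hb⟩ := exists_equiv_of_card_eq (W := Fin n) (by simpa) hab
    (c := ⟨0, by lia⟩) (d := ⟨1, hn⟩) (by simp)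
  refine ⟨φ.toEmbedding.trans Fin.valEmbedding, ?_, by simp [mask, ha, hb]⟩
  rw [← Finset.map_map, Finset.map_univ_equiv, Fin.map_valEmbedding_univ, Nat.Iio_eq_range]

/-- The mask of an edge. -/
abbrev edgeMask [DecidableEq V] (f : V ↪ ℕ) (e : Sym2 V) : ℕ :=
  mask f e.toFinset

theorem edgeMask_injective [DecidableEq V] : Function.Injective (edgeMask f) :=
  fun e e' h => Sym2.ext fun x => by
    rw [← Sym2.mem_toFinset, mask_injective h, Sym2.mem_toFinset]

theorem image_edgeMask_allEdges [Fintype V] [DecidableEq V] {n : ℕ}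
    (hf : Finset.univ.map f = Finset.range n) :
    (allEdges V).image (edgeMask f) = (subsets n 2).toFinset := by
  ext m
  simp only [List.mem_toFinset, mem_subsets_iff_exists_mask hf, Finset.mem_image, mem_allEdges]
  constructor
  · rintro ⟨e, he, rfl⟩
    exact ⟨_, e.card_toFinset_of_not_isDiag he, rfl⟩
  · rintro ⟨s, hs, rfl⟩
    obtain ⟨x, y, hxy, rfl⟩ := Finset.card_eq_two.1 hs
    exact ⟨s(x, y), hxy, by rw [edgeMask, Sym2.toFinset_mk_eq]⟩

theorem forces_of_wins [Fintype V] [DecidableEq V] {n q r : ℕ} (h : wins n q r)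
    (hV : Fintype.card V = n) {e : Sym2 V} (he : e ∈ allEdges V) :
    Forces (fun M _ => (graph M)ᶜ.CliqueFree q ∧ ¬(graph M).CliqueFree r) true
      ((allEdges V).erase e) ∅ {e} := by
  induction e with | _ a b
  obtain ⟨f, hf, hab⟩ := exists_mask_eq_three hV (mem_allEdges.1 he)
  rw [← Sym2.toFinset_mk_eq] at hab
  have hforces := forces_masks_of_wins h
  rw [← image_edgeMask_allEdges hf, ← hab, ← Finset.image_erase edgeMask_injective,
    ← Finset.image_empty (edgeMask f), ← Finset.image_singleton (edgeMask f),
    forces_image_iff edgeMask_injective.injOn] at hforces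
  refine hforces.with_union.mono ?_
  rintro M T ⟨⟨h₁, k, hk, h₂⟩, hMT⟩
  have hM : ∀ e ∈ M, ¬e.IsDiag := fun e heM => mem_allEdges.1 <| by
    have hmem := Finset.mem_union_left T heM
    rw [hMT, Finset.mem_union, Finset.union_empty, Finset.mem_erase, Finset.mem_singleton] at hmem
    rcases hmem with ⟨-, hmem⟩ | rfl
    exacts [hmem, he]
  constructor
  · intro s hs
    obtain ⟨e, heM, hes⟩ := h₁ _ ((mem_subsets_iff_exists_mask hf).2 ⟨s, hs.card_eq, rfl⟩)
    obtain ⟨e, he', rfl⟩ := Finset.mem_image.1 heM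
    rw [submask_mask_iff] at hes
    induction e with | _ x y
    have hxy : x ≠ y := hM _ he'
    exact (hs.isClique (hes (by simp)) (hes (by simp)) hxy).2
      ((SimpleGraph.fromEdgeSet_adj _).2 ⟨he', hxy⟩)
  · obtain ⟨s, hs, rfl⟩ := (mem_subsets_iff_exists_mask hf).1 hk
    refine fun hfree => hfree s ⟨fun x hx y hy hxy => ?_, hs⟩
    refine (SimpleGraph.fromEdgeSet_adj _).2 ⟨?_, hxy⟩
    have hmem : edgeMask f s(x, y) ∈ subsets n 2 := by
      rw [← List.mem_toFinset, ← image_edgeMask_allEdges hf]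
      exact Finset.mem_image_of_mem _ (mem_allEdges.2 hxy)
    refine edgeMask_injective.mem_finset_image.1 (h₂ _ hmem ?_)
    rw [submask_mask_iff, Sym2.toFinset_mk_eq]
    grind

end Masks

section Ramsey

variable {V : Type*} {G : SimpleGraph V}

theorem degree_le_of_cliqueFree_three [Fintype V] [DecidableRel G.Adj] {k : ℕ}
    (hG : G.CliqueFree 3) (hGc : Gᶜ.CliqueFree (k + 1)) (v : V) : G.degree v ≤ k := by
  refine Nat.lt_succ_iff.1 (lt_of_not_ge fun h => ?_)
  refine hGc.mono h (G.neighborFinset v) ⟨?_, G.card_neighborFinset_eq_degree v⟩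
  rw [G.coe_neighborFinset, SimpleGraph.isClique_compl]
  exact G.isIndepSet_neighborSet_of_triangleFree hG v

theorem two_mul_ncard_edgeSet_le [Fintype V] {k : ℕ} (hG : G.CliqueFree 3)
    (hGc : Gᶜ.CliqueFree (k + 1)) : 2 * G.edgeSet.ncard ≤ k * Fintype.card V := by
  classical
  rw [← SimpleGraph.coe_edgeFinset, Set.ncard_coe_finset, ← G.sum_degrees_eq_twice_card_edges,
    mul_comm, ← smul_eq_mul, ← Finset.card_univ]
  exact Finset.sum_le_card_nsmul _ _ _ fun v _ => degree_le_of_cliqueFree_three hG hGc v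

theorem exists_compl_isNClique_three_of_six_le {W : Finset V} (hG : G.CliqueFree 3)
    (hW : 6 ≤ W.card) : ∃ s ⊆ W, Gᶜ.IsNClique 3 s := by
  classical
  obtain ⟨v, hv⟩ := Finset.card_pos.1 (hW.trans_lt' (by simp))
  have hsplit := (W.erase v).card_filter_add_card_filter_not (G.Adj v ·)
  rw [Finset.card_erase_of_mem hv] at hsplit
  rcases le_or_gt 3 ((W.erase v).filter (G.Adj v)).card with h | h
  · obtain ⟨s, hs, hs3⟩ := Finset.exists_subset_card_eq h
    refine ⟨s, fun x hx => Finset.mem_of_mem_erase (Finset.mem_filter.1 (hs hx)).1,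
      ⟨(G.isClique_compl).2 ?_, hs3⟩⟩
    exact (G.isIndepSet_neighborSet_of_triangleFree hG v).mono
      fun x hx => (Finset.mem_filter.1 (hs hx)).2
  · obtain ⟨s, hs, hs3⟩ := Finset.exists_subset_card_eq
      (show 3 ≤ ((W.erase v).filter (¬G.Adj v ·)).card by lia)
    have hnot : ¬G.IsClique s := fun h => hG s ⟨h, hs3⟩
    simp only [SimpleGraph.IsClique, Set.Pairwise] at hnot
    push Not at hnot
    obtain ⟨x, hx, y, hy, hxy, hadj⟩ := hnot
    have hx' := hs hx
    have hy' := hs hy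
    exact ⟨{v, x, y}, by grind,
      SimpleGraph.is3Clique_triple_iff.2 (by grind [SimpleGraph.compl_adj])⟩

theorem not_compl_cliqueFree_four_of_card_eq_nine [Fintype V] (hG : G.CliqueFree 3)
    (hV : Fintype.card V = 9) : ¬Gᶜ.CliqueFree 4 := by
  classical
  intro hGc
  obtain ⟨v, hv⟩ : ∃ v, G.degree v ≤ 2 := by
    by_contra! h
    have hdeg : ∀ v, G.degree v = 3 := fun v =>
      (degree_le_of_cliqueFree_three hG hGc v).antisymm (h v)
    have hsum := G.sum_degrees_eq_twice_card_edges
    simp only [hdeg, Finset.sum_const, Finset.card_univ, hV, smul_eq_mul] at hsum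
    lia
  have hcard : 6 ≤ (Gᶜ.neighborFinset v).card := by
    rw [SimpleGraph.card_neighborFinset_eq_degree, SimpleGraph.degree_compl]
    lia
  obtain ⟨s, hs, hs3⟩ := exists_compl_isNClique_three_of_six_le hG hcard
  exact hGc _ (hs3.insert fun b hb => (SimpleGraph.mem_neighborFinset ..).1 (hs hb))

theorem not_compl_cliqueFree_four_of_nine_le [Fintype V] (hG : G.CliqueFree 3)
    (hV : 9 ≤ Fintype.card V) : ¬Gᶜ.CliqueFree 4 := by
  obtain ⟨f⟩ : Nonempty (Fin 9 ↪ V) := Function.Embedding.nonempty_of_card_le (by simpa)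
  let φ : G.comap f ↪g G := .comap f G
  exact fun hGc => not_compl_cliqueFree_four_of_card_eq_nine (hG.comap ⟨φ.toCopy⟩) (by simp)
    (hGc.comap ⟨(SimpleGraph.Embedding.complEquiv φ).toCopy⟩)

end Ramsey

section FinalPosition

variable {V : Type*} {M T : Finset (Sym2 V)}

theorem graph_le_compl_graph (h : Disjoint M T) : graph T ≤ (graph M)ᶜ := by
  intro x y hxy
  simp only [SimpleGraph.compl_adj, SimpleGraph.fromEdgeSet_adj] at hxy ⊢
  exact ⟨hxy.2, fun hM => Finset.disjoint_left.1 h hM.1 hxy.1⟩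

theorem compl_graph_le_graph [Fintype V] [DecidableEq V] (h : M ∪ T = allEdges V) :
    (graph M)ᶜ ≤ graph T := by
  intro x y hxy
  have hmem : s(x, y) ∈ M ∪ T := h ▸ mem_allEdges.2 hxy.1
  simp only [SimpleGraph.compl_adj, SimpleGraph.fromEdgeSet_adj, Finset.mem_union] at hxy hmem ⊢
  exact ⟨hmem.resolve_left fun hM => hxy.2 ⟨hM, hxy.1⟩, hxy.1⟩

theorem four_le_cliqueNum_of_nine_le [Fintype V] [DecidableEq V] (hV : 9 ≤ Fintype.card V)
    (hU : M ∪ T = allEdges V) (h : (graph T).cliqueNum < (graph M).cliqueNum) :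
    4 ≤ (graph M).cliqueNum := by
  by_contra! hM
  have hT : (graph T).cliqueNum < 3 := h.trans_le (Nat.lt_succ_iff.1 hM)
  refine not_compl_cliqueFree_four_of_nine_le (cliqueNum_lt_iff.1 hT) hV ?_
  exact (cliqueNum_lt_iff.1 hM).anti (compl_graph_le_graph (Finset.union_comm M T ▸ hU))

end FinalPosition

section SmallBoards

theorem secondPlayerWins_of_forall {n : ℕ} (h : ∀ e ∈ allEdges (Fin n),
    Forces (fun B A => (graph A).cliqueNum ≤ (graph B).cliqueNum) true
      ((allEdges (Fin n)).erase e) ∅ {e}) : SecondPlayerWins n :=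
  secondPlayerWins_iff.2 (forces_false_of (fun _ => le_rfl) h)

theorem secondPlayerWins_of_wins {n r : ℕ} (h : wins n (r + 1) r) : SecondPlayerWins n := by
  refine secondPlayerWins_of_forall fun e he => ?_
  refine ((forces_of_wins h (Fintype.card_fin n) he).with_disjoint (by simp) (by simp)).mono ?_
  rintro B A ⟨⟨hA, hB⟩, hBA⟩
  exact (Nat.lt_succ_iff.1 (cliqueNum_lt_iff.2 (hA.anti (graph_le_compl_graph hBA)))).trans
    (not_lt.1 fun hlt => hB (cliqueNum_lt_iff.1 hlt))

theorem wins_eight_four_zero : wins 8 4 0 := by decide +kernel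

/-- If Bob blocks every red clique of four vertices, a red victory leaves the blue graph without
triangles and without four independent vertices, hence with at most `12` edges. But Alice owns at
most `15` of the `28` edges. -/
theorem secondPlayerWins_eight : SecondPlayerWins 8 := by
  refine secondPlayerWins_of_forall fun e he => ?_
  refine ((forces_of_wins wins_eight_four_zero (Fintype.card_fin 8) he).with_disjoint
    (by simp) (by simp)).with_union.with_card.mono ?_
  rintro B A ⟨⟨⟨⟨hA, -⟩, hBA⟩, hU⟩, hcard⟩
  have hU' : B ∪ A = allEdges (Fin 8) := by
    rw [hU, Finset.union_empty, Finset.union_singleton, Finset.insert_erase he]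
  have hallEdges : (allEdges (Fin 8)).card = 28 := by
    rw [SimpleGraph.card_edgeFinset_top_eq_card_choose_two, Fintype.card_fin]; rfl
  rw [Finset.card_singleton, Finset.card_erase_of_mem he, hallEdges] at hcard
  have hA4 := cliqueNum_lt_iff.2 (hA.anti (graph_le_compl_graph hBA))
  by_contra! hlt
  have hB3 : (graph B).cliqueNum < 3 := by lia
  have hB : (graph B).edgeSet = B := (SimpleGraph.edgeSet_eq_iff _ _).2
    ⟨rfl, Set.disjoint_left.2 fun e heB => mem_allEdges.1 (hU' ▸ Finset.mem_union_left A heB)⟩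
  have hedges := two_mul_ncard_edgeSet_le (cliqueNum_lt_iff.1 hB3) hA
  rw [hB, Set.ncard_coe_finset, Fintype.card_fin] at hedges
  have := Finset.card_union_of_disjoint hBA
  rw [hU', hallEdges] at this
  lia

theorem secondPlayerWins_of_le_eight {n : ℕ} (h3 : 3 ≤ n) (h8 : n ≤ 8) : SecondPlayerWins n := by
  interval_cases n
  · exact secondPlayerWins_of_wins (r := 2) (by decide +kernel)
  · exact secondPlayerWins_of_wins (r := 2) (by decide +kernel)
  · exact secondPlayerWins_of_wins (r := 3) (by decide +kernel)
  · exact secondPlayerWins_of_wins (r := 3) (by decide +kernel)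
  · exact secondPlayerWins_of_wins (r := 3) (by decide +kernel)
  · exact secondPlayerWins_eight

end SmallBoards

section Endgame

variable {V : Type*}

theorem cliqueNum_le_of_star [DecidableEq V] {R : SimpleGraph V} {r p q : V} {m : ℕ}
    {X : Finset V} (hm : 4 ≤ m)
    (hoff : ∀ s : Finset V, R.IsClique s → Disjoint s {r, p, q} → s.card < m)
    (hrp : ¬R.Adj r p) (hrq : ¬R.Adj r q) (hX : X.card ≤ 2)
    (hpq : ∀ x ≠ r, R.Adj x p → R.Adj x q → x ∈ X) : R.cliqueNum ≤ m := by
  obtain ⟨s, hs⟩ := R.exists_isNClique_cliqueNum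
  rw [← hs.card_eq]
  have hadj : ∀ x ∈ s, ∀ y ∈ s, x ≠ y → R.Adj x y := hs.isClique
  by_cases hpqs : p ∈ s ∧ q ∈ s ∧ p ≠ q
  · have hsub : s ⊆ X ∪ {p, q} := by
      intro x hx
      by_cases hxpq : x = p ∨ x = q
      · grind
      · exact Finset.mem_union_left _ (hpq x (by grind) (by grind) (by grind))
    exact ((Finset.card_le_card hsub).trans (Finset.card_union_le _ _)).trans
      (by have := Finset.card_le_two (a := p) (b := q); lia)
  · have hone : (s ∩ {r, p, q}).card ≤ 1 := by
      refine Finset.card_le_one.2 fun x hx y hy => ?_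
      by_contra hxy
      have := R.adj_comm
      simp only [Finset.mem_inter, Finset.mem_insert, Finset.mem_singleton] at hx hy
      grind
    have hlt := hoff (s \ {r, p, q}) (hs.isClique.subset (by simp)) Finset.sdiff_disjoint
    have := Finset.card_sdiff_add_card_inter s {r, p, q}
    lia

/-- The player owns a larger clique than the opponent, and one with at least four vertices. -/
def HasBigClique (M T : Finset (Sym2 V)) : Prop :=
  4 ≤ (graph M).cliqueNum ∧ (graph T).cliqueNum < (graph M).cliqueNum

theorem monotoneGoal_hasBigClique [Finite V] : MonotoneGoal (HasBigClique (V := V)) := by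
  rintro M M' T T' hM hT ⟨h4, hlt⟩
  have hM := cliqueNum_mono (graph_mono hM)
  exact ⟨h4.trans hM, (cliqueNum_mono (graph_mono hT)).trans_lt (hlt.trans_le hM)⟩

/-- Neither end of the edge `e` lies in `S`. -/
def Avoids (S : Finset V) (e : Sym2 V) : Prop :=
  ∀ x ∈ S, x ∉ e

instance [DecidableEq V] (S : Finset V) : DecidablePred (Avoids S) :=
  fun e => inferInstanceAs (Decidable (∀ x ∈ S, x ∉ e))

theorem avoids_mk_iff {S : Finset V} {x y : V} :
    Avoids S s(x, y) ↔ x ∉ S ∧ y ∉ S := by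
  simp only [Avoids, Sym2.mem_iff, not_or]
  grind

theorem avoids_pair_iff [DecidableEq V] {u v : V} {e : Sym2 V} :
    Avoids {u, v} e ↔ u ∉ e ∧ v ∉ e := by
  simp [Avoids]

theorem avoids_triple_iff [DecidableEq V] {r p q : V} {e : Sym2 V} :
    Avoids {r, p, q} e ↔ r ∉ e ∧ p ∉ e ∧ q ∉ e := by
  simp [Avoids]

theorem cliqueNum_le_of_pairing [Finite V] [DecidableEq V] {r p q : V} {M T A : Finset (Sym2 V)}
    {X : Finset V}
    (hbig : HasBigClique (M.filter (Avoids {r, p, q})) (T.filter (Avoids {r, p, q})))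
    (hrp : s(r, p) ∉ T) (hrq : s(r, q) ∉ T)
    (hpair : ∀ x, x ≠ p → x ≠ q → s(x, p) ∈ T → s(x, q) ∈ T → s(x, p) ∈ A ∨ s(x, q) ∈ A)
    (hX : X.card ≤ 2) (hAX : ∀ x ∉ ({r, p, q} : Finset V), s(x, p) ∈ A ∨ s(x, q) ∈ A → x ∈ X) :
    (graph T).cliqueNum ≤ (graph M).cliqueNum := by
  refine le_trans (cliqueNum_le_of_star (r := r) (p := p) (q := q) hbig.1 (fun s hs hdisj => ?_)
    (fun h => hrp h.1) (fun h => hrq h.1) hX fun x hx hxp hxq =>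
      hAX x (by simp [hx, hxp.2, hxq.2]) (hpair x hxp.2 hxq.2 hxp.1 hxq.1))
    (cliqueNum_mono (graph_mono (Finset.filter_subset _ M)))
  have hoff : (graph (T.filter (Avoids {r, p, q}))).IsClique s := fun x hx y hy hxy =>
    ⟨Finset.mem_coe.2 (Finset.mem_filter.2 ⟨(hs hx hy hxy).1, avoids_mk_iff.2
      ⟨Finset.disjoint_left.1 hdisj hx, Finset.disjoint_left.1 hdisj hy⟩⟩), hxy⟩
  exact hoff.card_le_cliqueNum.trans_lt hbig.2

theorem card_toFinset_sdiff_le_one [DecidableEq V] {S : Finset V} {e : Sym2 V} (he : ¬Avoids S e) :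
    (e.toFinset \ S).card ≤ 1 := by
  induction e with | _ x y
  refine Finset.card_le_one.2 fun z hz w hw => ?_
  rw [avoids_mk_iff] at he
  simp only [Finset.mem_sdiff, Sym2.mem_toFinset, Sym2.mem_iff] at hz hw
  grind

variable [Fintype V] [DecidableEq V]

/-- The edges of the complete graph on the vertices outside `S`. -/
abbrev edgesOff (S : Finset V) : Finset (Sym2 V) :=
  (allEdges V).filter (Avoids S)

theorem image_map_allEdges {W : Type*} [Fintype W] [DecidableEq W] {S : Finset V}
    (φ : W ≃ {x // x ∉ S}) :
    (allEdges W).image (Sym2.map (φ.toEmbedding.trans (.subtype _))) = edgesOff S := by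
  ext e
  simp only [Finset.mem_image, Finset.mem_filter, mem_allEdges]
  constructor
  · rintro ⟨e, he, rfl⟩
    induction e with | _ x y
    have hxy : φ x ≠ φ y := φ.injective.ne he
    exact ⟨fun h => hxy (Subtype.ext h), avoids_mk_iff.2 ⟨(φ x).2, (φ y).2⟩⟩
  · rintro ⟨hne, hS⟩
    induction e with | _ x y
    obtain ⟨hx, hy⟩ := avoids_mk_iff.1 hS
    refine ⟨s(φ.symm ⟨x, hx⟩, φ.symm ⟨y, hy⟩), fun h => ?_, by simp⟩
    exact hne (congrArg Subtype.val (φ.symm.injective h))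

theorem forces_hasBigClique_edgesOff {n : ℕ} (h : FirstPlayerWins n) (hn : 9 ≤ n) {S : Finset V}
    (hV : Fintype.card V = n + S.card) {e₀ : Sym2 V} (he₀ : e₀ ∈ edgesOff S) :
    Forces HasBigClique false ((edgesOff S).erase e₀) {e₀} ∅ := by
  obtain ⟨he₀, hS⟩ := Finset.mem_filter.1 he₀
  induction e₀ with | _ a b
  obtain ⟨ha, hb⟩ := avoids_mk_iff.1 hS
  have hn0 : NeZero n := ⟨by lia⟩
  have hbig : Forces HasBigClique true (allEdges (Fin n)) ∅ ∅ :=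
    (firstPlayerWins_iff.1 h).with_union.mono fun M T ⟨hlt, hU⟩ =>
      ⟨four_le_cliqueNum_of_nine_le (by simpa using hn) (by simpa using hU) hlt, hlt⟩
  obtain ⟨e, he, hbig⟩ := hbig.exists_move
    ⟨s(⟨0, by lia⟩, ⟨1, by lia⟩), mem_allEdges.2 (by simp)⟩
  induction e with | _ x y
  obtain ⟨φ, hφx, hφy⟩ := exists_equiv_of_card_eq (W := {x // x ∉ S})
    (by simp [hV]) (mem_allEdges.1 he) (c := ⟨a, ha⟩) (d := ⟨b, hb⟩) (by simpa using he₀)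
  set ψ : Fin n ↪ V := φ.toEmbedding.trans (.subtype _)
  have hψ : Function.Injective (Sym2.map ψ) := Sym2.map.injective ψ.injective
  have hxy : Sym2.map ψ s(x, y) = s(a, b) := by simp [ψ, hφx, hφy]
  have hmap := (forces_image_iff (R := HasBigClique) hψ.injOn).2 <| hbig.mono fun M T h => by
    simpa only [HasBigClique, graph_image_map, cliqueNum_map] using h
  simpa only [Finset.image_erase hψ, image_map_allEdges, hxy, insert_empty_eq,
    Finset.image_singleton, Finset.image_empty, ψ] using hmap

/-- Bob wins from the position in which he owns the edges in `B`, Alice owns the edges in `A`, and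
Alice is to move. -/
def SecondWinsFrom (B A : Finset (Sym2 V)) : Prop :=
  Forces (fun B' A' => (graph A').cliqueNum ≤ (graph B').cliqueNum) false
    (allEdges V \ (B ∪ A)) B A

/-- Away from `r`, `p`, `q` Bob plays the clique game, elsewhere he pairs `xp` with `xq`. Only the
vertices of `X` can then be joined to both `p` and `q` in red. -/
theorem secondWinsFrom_of_star {r p q : V} {e₀ : Sym2 V} {A : Finset (Sym2 V)} {X : Finset V}
    (hbig : Forces HasBigClique false ((edgesOff {r, p, q}).erase e₀) {e₀} ∅)
    (hpq : p ≠ q) (he₀ : e₀ ∈ edgesOff {r, p, q}) (hA : ∀ e ∈ A, ¬Avoids {r, p, q} e)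
    (hrp : s(r, p) ∉ A) (hrq : s(r, q) ∉ A) (hX : X.card ≤ 2)
    (hAX : ∀ x ∉ ({r, p, q} : Finset V), s(x, p) ∈ A ∨ s(x, q) ∈ A → x ∈ X) :
    SecondWinsFrom {s(r, p), s(r, q), e₀} A := by
  set B : Finset (Sym2 V) := {s(r, p), s(r, q), e₀} with hB
  have hpoff : ∀ x, ¬Avoids {r, p, q} s(x, p) := by simp [avoids_mk_iff]
  have hqoff : ∀ x, ¬Avoids {r, p, q} s(x, q) := by simp [avoids_mk_iff]
  obtain ⟨he₀, havoid⟩ := Finset.mem_filter.1 he₀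
  have hMoff : B.filter (Avoids {r, p, q}) = {e₀} := by
    simp only [hB, Finset.filter_insert, Finset.filter_singleton, hpoff, hqoff, havoid, if_true,
      if_false]
  have hToff : A.filter (Avoids {r, p, q}) = ∅ := Finset.filter_eq_empty_iff.2 fun e => hA e
  have hUoff : (allEdges V \ (B ∪ A)).filter (Avoids {r, p, q}) =
      (edgesOff {r, p, q}).erase e₀ := by
    have : (B ∪ A).filter (Avoids {r, p, q}) = {e₀} := by
      rw [Finset.filter_union, hMoff, hToff, Finset.union_empty]
    rw [← Finset.sdiff_singleton_eq_erase, ← this]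
    grind
  have hσ : Function.Involutive (Sym2.map (Equiv.swap p q)) := fun e => by simp [Sym2.map_map]
  have hdisj : Disjoint B A := by
    have he₀A : e₀ ∉ A := fun h => hA _ h havoid
    simp [hB, hrp, hrq, he₀A]
  rw [← hUoff, ← hMoff, ← hToff] at hbig
  have hplay := (hbig.prod _ monotoneGoal_hasBigClique
    (fun _ _ _ _ _ hT h e hne he he' => h e hne (hT he) (hT he')) (forces_pairing hσ)
    ).with_subset.with_disjoint hdisj Finset.sdiff_disjoint
  refine hplay.mono fun M' T' ⟨⟨⟨hbig, hpair⟩, hM⟩, hMT⟩ => ?_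
  have hT : ∀ e ∈ B, e ∉ T' := fun e he => Finset.disjoint_left.1 hMT (hM he)
  refine cliqueNum_le_of_pairing hbig (hT _ (by simp [hB])) (hT _ (by simp [hB]))
    (fun x hp hq hxp hxq => ?_) hX hAX
  have hswap : Sym2.map (Equiv.swap p q) s(x, p) = s(x, q) := by
    rw [Sym2.map_mk, Equiv.swap_apply_of_ne_of_ne hp hq, Equiv.swap_apply_left]
  have hne : s(x, q) ≠ s(x, p) := fun h => hpq (Sym2.congr_right.1 h).symm
  have hpairx := hpair s(x, p)
  rw [hswap] at hpairx
  exact (hpairx hne (Finset.mem_filter.2 ⟨hxp, hpoff x⟩) (Finset.mem_filter.2 ⟨hxq, hqoff x⟩)).imp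
    (Finset.mem_of_mem_filter _) (Finset.mem_of_mem_filter _)

/-- The edge `e₁` is wasted: the pairing never has to answer it. Each of `e₂` and `e₃` contributes
at most one vertex to the set `X` of `secondWinsFrom_of_star`. -/
theorem secondWinsFrom_of_wasted {r p q : V} {e₀ e₁ e₂ e₃ : Sym2 V}
    (hbig : Forces HasBigClique false ((edgesOff {r, p, q}).erase e₀) {e₀} ∅)
    (hp : p ≠ r) (hq : q ≠ r) (hpq : p ≠ q) (he₀ : e₀ ∈ edgesOff {r, p, q})
    (h₁ : r ∈ e₁ ∨ e₁ = s(p, q)) (h₂ : ¬Avoids {r, p, q} e₂) (h₃ : ¬Avoids {r, p, q} e₃)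
    (hrp : s(r, p) ∉ ({e₁, e₂, e₃} : Finset _)) (hrq : s(r, q) ∉ ({e₁, e₂, e₃} : Finset _)) :
    SecondWinsFrom {s(r, p), s(r, q), e₀} {e₁, e₂, e₃} := by
  have hqS : ∀ x, ¬Avoids {r, p, q} s(x, q) := by simp [avoids_mk_iff]
  refine secondWinsFrom_of_star hbig hpq he₀ ?_ hrp hrq
    (X := (e₂.toFinset \ {r, p, q}) ∪ (e₃.toFinset \ {r, p, q}))
    ((Finset.card_union_le _ _).trans (add_le_add (card_toFinset_sdiff_le_one h₂)
      (card_toFinset_sdiff_le_one h₃))) fun x hx hxA => ?_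
  · have h₁S : ¬Avoids {r, p, q} e₁ := by
      rcases h₁ with h | rfl
      · exact fun hav => hav r (Finset.mem_insert_self _ _) h
      · exact hqS p
    simp only [Finset.forall_mem_insert, Finset.mem_singleton, forall_eq]
    exact ⟨h₁S, h₂, h₃⟩
  · have hwasted : e₁ ≠ s(x, p) ∧ e₁ ≠ s(x, q) := by grind [Sym2.eq_iff]
    have hxe : ∀ e, e = s(x, p) ∨ e = s(x, q) → x ∈ e.toFinset \ {r, p, q} := by
      rintro e (rfl | rfl) <;> simpa [Sym2.mem_toFinset] using hx
    grind

end Endgame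

section Opening

variable {V : Type*}

theorem exists_mem_notMem_of_ne {e f : Sym2 V} (he : ¬e.IsDiag) (h : e ≠ f) : ∃ x ∈ e, x ∉ f := by
  induction e with | _ x y
  by_contra! hsub
  exact h ((Sym2.mem_and_mem_iff he).1
    ⟨hsub x (Sym2.mem_mk_left x y), hsub y (Sym2.mem_mk_right x y)⟩).symm

theorem exists_notMem_forall_notMem [Fintype V] {S : Finset V} {E : Finset (Sym2 V)}
    (h : S.card + E.card * 2 < Fintype.card V) : ∃ x ∉ S, ∀ e ∈ E, x ∉ e := by
  classical
  have hE : (E.biUnion Sym2.toFinset).card ≤ E.card * 2 :=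
    Finset.card_biUnion_le_card_mul _ _ _ fun e _ => by grind [Sym2.card_toFinset]
  obtain ⟨x, -, hx⟩ := Finset.exists_mem_notMem_of_card_lt_card (t := Finset.univ)
    ((Finset.card_union_le S (E.biUnion Sym2.toFinset)).trans_lt (by rw [Finset.card_univ]; lia))
  exact ⟨x, by simpa using hx⟩

variable [Fintype V] [DecidableEq V]

theorem six_le_card_allEdges (hV : 4 ≤ Fintype.card V) : 6 ≤ (allEdges V).card := by
  rw [SimpleGraph.card_edgeFinset_top_eq_card_choose_two]
  exact Nat.choose_le_choose 2 hV

/-- In the position with blue edges `B` and red edges `A`, Bob has a winning answer to Alice's move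
`e`. -/
def HasAnswer (B A : Finset (Sym2 V)) (e : Sym2 V) : Prop :=
  ∃ f ∈ (allEdges V \ (B ∪ A)).erase e, SecondWinsFrom (insert f B) (insert e A)

theorem secondWinsFrom_of_hasAnswer {B A : Finset (Sym2 V)}
    (hcard : B.card + A.card < (allEdges V).card)
    (h : ∀ e ∈ allEdges V \ (B ∪ A), HasAnswer B A e) : SecondWinsFrom B A := by
  refine .reply ?_ fun e he => ?_
  · rw [Finset.sdiff_nonempty]
    exact fun hsub => hcard.not_ge ((Finset.card_le_card hsub).trans (Finset.card_union_le B A))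
  · obtain ⟨f, hf, hwin⟩ := h e he
    refine .move f hf ?_
    rw [SecondWinsFrom] at hwin
    convert hwin using 1
    grind

/-- For any three vertices and any edge avoiding them, Bob can force a big clique on the remaining
vertices when that edge is his first move there. -/
def ForcesBigCliqueOff (V : Type*) [Fintype V] [DecidableEq V] : Prop :=
  ∀ S : Finset V, S.card = 3 → ∀ e₀ ∈ edgesOff S,
    Forces HasBigClique false ((edgesOff S).erase e₀) {e₀} ∅

theorem ForcesBigCliqueOff.hasAnswer_of_wasted (h : ForcesBigCliqueOff V) {r p q : V}
    {B A : Finset (Sym2 V)} {e₀ e₁ e₂ e₃ : Sym2 V} (hB : B = {s(r, p), e₀}) (hA : A = {e₁, e₂})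
    (hrp : r ≠ p) (hrq : r ≠ q) (hpq : p ≠ q) (he₀ : e₀ ∈ edgesOff {r, p, q})
    (h₁ : r ∈ e₁ ∨ e₁ = s(p, q)) (h₂ : ¬Avoids {r, p, q} e₂) (h₃ : ¬Avoids {r, p, q} e₃)
    (hrpA : s(r, p) ∉ insert e₃ A) (hrqA : s(r, q) ∉ insert e₃ A) : HasAnswer B A e₃ := by
  have hedges : s(r, q) ≠ s(r, p) ∧ s(r, q) ≠ e₀ := by
    have : ¬Avoids {r, p, q} s(r, q) := by simp [avoids_mk_iff]
    grind
  refine ⟨s(r, q), by simp_all, ?_⟩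
  have hwins := secondWinsFrom_of_wasted (e₁ := e₁) (e₂ := e₂) (e₃ := e₃)
    (h {r, p, q} (Finset.card_eq_three.2 ⟨r, p, q, hrp, hrq, hpq, rfl⟩) e₀ he₀)
    hrp.symm hrq.symm hpq he₀ h₁ h₂ h₃
  convert hwins (by grind) (by grind) using 1
  · grind
  · grind

section ThirdMove

variable {u v p : V} {e₀ e₂ e₃ : Sym2 V}

theorem ForcesBigCliqueOff.hasAnswer_of_mem (h : ForcesBigCliqueOff V) (hV : 12 ≤ Fintype.card V)
    (hup : u ≠ p) (hvp : v ≠ p) (he₀ : e₀ ∈ edgesOff {u, v, p}) (he₂ : u ∈ e₂ ∨ p ∈ e₂)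
    (hupe₂ : e₂ ≠ s(u, p)) (hupe₃ : e₃ ≠ s(u, p)) (he₃ : u ∈ e₃ ∨ p ∈ e₃) :
    HasAnswer {s(u, p), e₀} {s(u, v), e₂} e₃ := by
  obtain ⟨q, hqS, hqE⟩ := exists_notMem_forall_notMem (S := {u, v, p}) (E := {e₀, e₂, e₃})
    (by have := Finset.card_le_three (a := u) (b := v) (c := p)
        have := Finset.card_le_three (a := e₀) (b := e₂) (c := e₃)
        lia)
  simp only [Finset.mem_insert, Finset.mem_singleton, not_or, forall_eq_or_imp, forall_eq]
    at hqS hqE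
  refine h.hasAnswer_of_wasted (r := u) (p := p) (q := q) rfl rfl hup (by tauto) (by tauto) ?_
    (.inl (Sym2.mem_mk_left u v)) ?_ ?_ ?_ ?_
  all_goals grind [avoids_triple_iff]

theorem ForcesBigCliqueOff.hasAnswer_of_mem_outer (h : ForcesBigCliqueOff V)
    (huv : u ≠ v) (hup : u ≠ p) (hvp : v ≠ p) (he₀ : e₀ ∈ edgesOff {u, v, p})
    (he₂ : u ∈ e₂ ∨ p ∈ e₂) (hve₂ : v ∉ e₂) (hupe₂ : e₂ ≠ s(u, p)) (hpe₃ : p ∉ e₃) (hve₃ : v ∈ e₃) :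
    HasAnswer {s(u, p), e₀} {s(u, v), e₂} e₃ := by
  refine h.hasAnswer_of_wasted (r := p) (p := u) (q := v) (by rw [Sym2.eq_swap]) rfl hup.symm
    hvp.symm huv ?_ (.inr rfl) ?_ ?_ ?_ ?_
  all_goals grind [avoids_triple_iff]

theorem ForcesBigCliqueOff.hasAnswer_of_avoids (h : ForcesBigCliqueOff V)
    (hup : u ≠ p) (hvp : v ≠ p) (he₀ : e₀ ∈ edgesOff {u, v, p}) (he₂ : u ∈ e₂ ∨ p ∈ e₂)
    (hupe₂ : e₂ ≠ s(u, p)) (he₃ : e₃ ∈ edgesOff {u, v, p}) (hne : e₃ ≠ e₀) :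
    HasAnswer {s(u, p), e₀} {s(u, v), e₂} e₃ := by
  obtain ⟨he₃, hav⟩ := Finset.mem_filter.1 he₃
  obtain ⟨c, hce₃, hce₀⟩ := exists_mem_notMem_of_ne (mem_allEdges.1 he₃) hne
  have hc : c ∉ ({u, v, p} : Finset V) := fun h => hav c h hce₃
  by_cases hce₂ : e₂ = s(u, c)
  · refine h.hasAnswer_of_wasted (r := p) (p := u) (q := c) (e₁ := s(u, c)) (e₂ := s(u, v))
      (by rw [Sym2.eq_swap]) (by rw [hce₂, Finset.pair_comm]) hup.symm
      ?_ ?_ ?_ (.inr rfl) ?_ ?_ ?_ ?_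
    all_goals grind [avoids_triple_iff]
  · refine h.hasAnswer_of_wasted (r := u) (p := p) (q := c) rfl rfl hup ?_ ?_ ?_
      (.inl (Sym2.mem_mk_left u v)) ?_ ?_ ?_ ?_
    all_goals grind [avoids_triple_iff]

theorem ForcesBigCliqueOff.secondWinsFrom_two (h : ForcesBigCliqueOff V)
    (hV : 12 ≤ Fintype.card V) (huv : u ≠ v) (hup : u ≠ p) (hvp : v ≠ p)
    (he₀ : e₀ ∈ edgesOff {u, v, p}) (he₂ : u ∈ e₂ ∨ p ∈ e₂) (hve₂ : v ∉ e₂)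
    (hupe₂ : e₂ ≠ s(u, p)) : SecondWinsFrom {s(u, p), e₀} {e₂, s(u, v)} := by
  rw [Finset.pair_comm e₂]
  refine secondWinsFrom_of_hasAnswer ?_ fun e₃ he₃ => ?_
  · have := six_le_card_allEdges (V := V) (by lia)
    have := Finset.card_le_two (a := s(u, p)) (b := e₀)
    have := Finset.card_le_two (a := s(u, v)) (b := e₂)
    lia
  simp only [Finset.mem_sdiff, Finset.mem_union, Finset.mem_insert, Finset.mem_singleton,
    not_or] at he₃
  obtain ⟨he₃, ⟨hupe₃, hne⟩, -⟩ := he₃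
  by_cases hue₃ : u ∈ e₃ ∨ p ∈ e₃
  · exact h.hasAnswer_of_mem hV hup hvp he₀ he₂ hupe₂ hupe₃ hue₃
  obtain ⟨hue₃, hpe₃⟩ := not_or.1 hue₃
  by_cases hve₃ : v ∈ e₃
  · exact h.hasAnswer_of_mem_outer huv hup hvp he₀ he₂ hve₂ hupe₂ hpe₃ hve₃
  · exact h.hasAnswer_of_avoids hup hvp he₀ he₂ hupe₂
      (Finset.mem_filter.2 ⟨he₃, avoids_triple_iff.2 ⟨hue₃, hve₃, hpe₃⟩⟩) hne

end ThirdMove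

section SecondMove

variable {u v : V} {e₀ e₂ : Sym2 V}

theorem ForcesBigCliqueOff.hasAnswer_of_adjacent (h : ForcesBigCliqueOff V)
    (hV : 12 ≤ Fintype.card V) (huv : u ≠ v) (he₀ : e₀ ∈ edgesOff {u, v}) (hue₂ : u ∈ e₂)
    (huve₂ : e₂ ≠ s(u, v)) : HasAnswer {e₀} {s(u, v)} e₂ := by
  obtain ⟨p, hpS, hpE⟩ := exists_notMem_forall_notMem (S := {u, v}) (E := {e₀, e₂})
    (by have := Finset.card_le_two (a := u) (b := v)
        have := Finset.card_le_two (a := e₀) (b := e₂)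
        lia)
  simp only [Finset.mem_insert, Finset.mem_singleton, not_or, forall_eq_or_imp, forall_eq]
    at hpS hpE
  have hve₂ : v ∉ e₂ := fun hve₂ => huve₂ ((Sym2.mem_and_mem_iff huv).1 ⟨hue₂, hve₂⟩)
  have hpup := Sym2.mem_mk_right u p
  have hup : s(u, p) ∈ allEdges V := mem_allEdges.2 (Ne.symm hpS.1)
  refine ⟨s(u, p), ?_, h.secondWinsFrom_two hV huv ?_ ?_ ?_ (.inl hue₂) hve₂ ?_⟩
  all_goals grind [avoids_triple_iff, avoids_pair_iff]

theorem ForcesBigCliqueOff.hasAnswer_of_disjoint (h : ForcesBigCliqueOff V)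
    (hV : 12 ≤ Fintype.card V) (huv : u ≠ v) (he₀ : e₀ ∈ edgesOff {u, v})
    (he₂ : e₂ ∈ edgesOff {u, v}) (hne : e₂ ≠ e₀) : HasAnswer {e₀} {s(u, v)} e₂ := by
  obtain ⟨he₂, hav⟩ := Finset.mem_filter.1 he₂
  obtain ⟨p, hpe₂, hpe₀⟩ := exists_mem_notMem_of_ne (mem_allEdges.1 he₂) hne
  obtain ⟨hue₂, hve₂⟩ := avoids_pair_iff.1 hav
  have huup := Sym2.mem_mk_left u p
  have hpup := Sym2.mem_mk_right u p
  have hup : u ≠ p := fun h => hue₂ (h ▸ hpe₂)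
  have hup' : s(u, p) ∈ allEdges V := mem_allEdges.2 hup
  refine ⟨s(u, p), ?_, h.secondWinsFrom_two hV huv hup ?_ ?_ (.inr hpe₂) hve₂ ?_⟩
  all_goals grind [avoids_triple_iff, avoids_pair_iff]

theorem ForcesBigCliqueOff.secondWinsFrom_one (h : ForcesBigCliqueOff V)
    (hV : 12 ≤ Fintype.card V) (huv : u ≠ v) (he₀ : e₀ ∈ edgesOff {u, v}) :
    SecondWinsFrom {e₀} {s(u, v)} := by
  refine secondWinsFrom_of_hasAnswer ?_ fun e₂ he₂ => ?_
  · have := six_le_card_allEdges (V := V) (by lia)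
    simp only [Finset.card_singleton]
    lia
  simp only [Finset.mem_sdiff, Finset.mem_union, Finset.mem_singleton, not_or] at he₂
  obtain ⟨he₂, hne, huve₂⟩ := he₂
  by_cases hue₂ : u ∈ e₂
  · exact h.hasAnswer_of_adjacent hV huv he₀ hue₂ huve₂
  by_cases hve₂ : v ∈ e₂
  · rw [Sym2.eq_swap] at huve₂ ⊢
    exact h.hasAnswer_of_adjacent hV huv.symm (Finset.pair_comm u v ▸ he₀) hve₂ huve₂
  · exact h.hasAnswer_of_disjoint hV huv he₀
      (Finset.mem_filter.2 ⟨he₂, avoids_pair_iff.2 ⟨hue₂, hve₂⟩⟩) hne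

end SecondMove

theorem ForcesBigCliqueOff.secondWinsFrom_empty (h : ForcesBigCliqueOff V)
    (hV : 12 ≤ Fintype.card V) : SecondWinsFrom (∅ : Finset (Sym2 V)) ∅ := by
  refine secondWinsFrom_of_hasAnswer ?_ fun e he => ?_
  · have := six_le_card_allEdges (V := V) (by lia)
    simp only [Finset.card_empty]
    lia
  induction e with | _ u v
  have huv : u ≠ v := by simpa using he
  obtain ⟨a, ha, -⟩ := exists_notMem_forall_notMem (S := {u, v}) (E := ∅)
    (by have := Finset.card_le_two (a := u) (b := v); simp only [Finset.card_empty]; lia)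
  obtain ⟨b, hb, -⟩ := exists_notMem_forall_notMem (S := {u, v, a}) (E := ∅)
    (by have := Finset.card_le_three (a := u) (b := v) (c := a)
        simp only [Finset.card_empty]; lia)
  simp only [Finset.mem_insert, Finset.mem_singleton, not_or] at ha hb
  have hab : s(a, b) ∈ allEdges V := mem_allEdges.2 (Ne.symm hb.2.2)
  refine ⟨s(a, b), ?_, h.secondWinsFrom_one hV huv (Finset.mem_filter.2 ⟨hab, ?_⟩)⟩
  · simp only [Finset.empty_union, Finset.sdiff_empty, Finset.mem_erase]
    exact ⟨by rw [Ne, Sym2.eq_iff]; tauto, hab⟩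
  · rw [avoids_mk_iff]
    simp [ha, hb]

end Opening

theorem secondPlayerWins_add_three {n : ℕ} (hn : 9 ≤ n) (h : FirstPlayerWins n) :
    SecondPlayerWins (n + 3) := by
  have hoff : ForcesBigCliqueOff (Fin (n + 3)) := fun S hS e₀ =>
    forces_hasBigClique_edgesOff h hn (by rw [Fintype.card_fin, hS])
  have hwins := hoff.secondWinsFrom_empty (by rw [Fintype.card_fin]; lia)
  rw [SecondWinsFrom, Finset.empty_union, Finset.sdiff_empty] at hwins
  exact secondPlayerWins_iff.2 hwins

end CliqueGame

theorem mainTheorem5 :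
    (∀ n : ℕ, 8 ≤ n → CliqueGame.FirstPlayerWins n → CliqueGame.SecondPlayerWins (n + 3)) ∧
    (∀ n : ℕ, 3 ≤ n → n ≤ 8 → CliqueGame.SecondPlayerWins n) := by
  refine ⟨fun n hn h => ?_, fun n h3 h8 => CliqueGame.secondPlayerWins_of_le_eight h3 h8⟩
  rcases hn.eq_or_lt with rfl | hn
  · exact absurd h CliqueGame.secondPlayerWins_eight.not_gt
  · exact CliqueGame.secondPlayerWins_add_three hn h
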